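/- Let $T$ be a complete first-order theory in an arbitrary (one-sorted) language. A formula $\varphi(x,y)$, where $x$ and $y$ are finite tuples of variables, is called NIP (modulo $T$) if there are no model $M\models T$ and tuples $(a_i)_{i\in\omega}$, $(b_s)_{s\subseteq\omega}$ from $M$ such that for all $i\in\omega$ and $s\subseteq\omega$, $M\models\varphi(a_i,b_s)$ if and only if $i\in s$. The theory $T$ is called NIP if every formula $\varphi(x,y)$ is NIP. For $M\models T$, a set $A\subseteq M$ and a tuple $a$ from $M$ with $|a|=|y|$, write $$\varphi(A,a)=\{d\in A^{|x|} : M\models\varphi(d,a)\}.$$ Suppose that $T$ is NIP and let $\varphi(x,y)$ be a formula without parameters. Then there is a formula $\chi(x,t)$ without parameters, where $t$ is a finite tuple of variables, depending only on $T$ and $\varphi$, such that for every model $M\models T$, every set $A\subseteq M$ with $|A|\geq 2$, every tuple $a\in M^{|y|}$ and every finite subset $A_0\subseteq A$, there is a tuple $b\in A^{|t|}$ satisfying: 1. $\varphi(A_0,a)=\chi(A_0,b)$, 2. $\chi(A,b)\subseteq\varphi(A,a)$. -/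

import Mathlib

open FirstOrder FirstOrder.Language

universe u v w

namespace HonestDefinitions

variable {L : FirstOrder.Language.{u, v}} {n m : ℕ}

/-- The set `φ(A, a)`: all tuples `d` of elements of `A` (of the length of `x`) such that
`φ(d, a)` holds in `M`. -/
def trace {M : Type w} [L.Structure M] (φ : L.Formula (Fin n ⊕ Fin m)) (A : Set M)
    (a : Fin m → M) : Set (Fin n → M) :=
  {d | (∀ i, d i ∈ A) ∧ φ.Realize (Sum.elim d a)}

/-- `φ(x, y)` is NIP modulo `T`: no model of `T` contains tuples `a_t` (`t ∈ ω`) and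
`b_s` (`s ⊆ ω`) such that `φ(a_t, b_s)` holds if and only if `t ∈ s`. For complete `T` this is
the same as having no such tuples in a monster model. By compactness and Löwenheim–Skolem the
universe of the models considered does not matter. -/
def FormulaNIP (T : L.Theory) (φ : L.Formula (Fin n ⊕ Fin m)) : Prop :=
  ¬ ∃ (M : FirstOrder.Language.Theory.ModelType.{u, v, max u v} T)
      (a : ℕ → Fin n → M) (b : Set ℕ → Fin m → M),
      ∀ (t : ℕ) (s : Set ℕ), φ.Realize (Sum.elim (a t) (b s)) ↔ t ∈ s

/-- `T` is NIP: every formula `φ(x, y)`, with `x` and `y` finite tuples of variables,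
is NIP modulo `T`. -/
def TheoryNIP (T : L.Theory) : Prop :=
  ∀ (n m : ℕ) (φ : L.Formula (Fin n ⊕ Fin m)), FormulaNIP T φ

end HonestDefinitions

/-! By NIP some `N` bounds the VC dimension of `φ`, which drives two arguments.

Separation. In an ultraproduct, let `D` be a countable family in `φ(A, a)`, and let an ultrafilter
`U` on `D` play the role of a type finitely satisfiable in `D`. Suppose no conjunction of negated
patterns over `A` that holds `U`-generically implies `φ(·, a)` on `A`. Then for each pattern `s`
there is an `N`-tuple in `A` whose entries imitate `U`-generic ones while `φ(·, a)` cuts out exactly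
`s`. Replacing the imitations by elements of `D`, last entry first and for all `s` at once, yields
one shattered tuple: a contradiction. Compactness of the space of ultrafilters turns the separating
conjunctions into a finite disjunction (`exists_honest_shapes`).

Covering. This handles only `q` points at a time. The ε-net theorem and minimax, as in the
(p,q)-theorem, then cover any finite set by boundedly many instances (`exists_cover_bound`). Here
`q` depends on the VC dimensions attached to the shape of the disjunction, so `exists_honest_shapes`
accepts `q` as an arbitrary function of the shape. Two distinct elements of `A` finally encode
unions and the choice among finitely many formulas. -/

/-- Every pattern on the tuple `x` is cut out by some `R · y`. -/
def TupleShattered {X Y : Type*} (R : X → Y → Prop) {d : ℕ} (x : Fin d → X) : Prop :=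
  ∀ s : Set (Fin d), ∃ y, ∀ j, R (x j) y ↔ j ∈ s

/-! ### NIP and VC dimension -/

namespace HonestDefinitions

variable {L : FirstOrder.Language.{u, v}} {n m : ℕ}

open Classical in
/-- The formula `∃ y, ⋀ j, φ(x_j, y) ↔ j ∈ s`. -/
noncomputable def patternFormula (φ : L.Formula (Fin n ⊕ Fin m)) {d : ℕ} (s : Set (Fin d)) :
    L.Formula (Fin d × Fin n) :=
  Formula.iExs (Fin m) (Formula.iInf fun j : Fin d =>
    if j ∈ s then φ.relabel (Sum.map (fun i => (j, i)) id)
    else (φ.relabel (Sum.map (fun i => (j, i)) id)).not)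

theorem realize_patternFormula {M : Type w} [L.Structure M] (φ : L.Formula (Fin n ⊕ Fin m))
    {d : ℕ} (s : Set (Fin d)) (v : Fin d × Fin n → M) :
    (patternFormula φ s).Realize v ↔
      ∃ y, ∀ j, φ.Realize (Sum.elim (fun i => v (j, i)) y) ↔ j ∈ s := by
  simp only [patternFormula, Formula.realize_iExs, Formula.realize_iInf]
  refine exists_congr fun y => forall_congr' fun j => ?_
  have h : (Sum.elim v y ∘ Sum.map (fun i => (j, i)) id : Fin n ⊕ Fin m → M) =
      Sum.elim (fun i => v (j, i)) y := by
    funext i; rcases i with i | i <;> rfl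
  split_ifs with hj
  · rw [Formula.realize_relabel, h]; simp [hj]
  · rw [Formula.realize_not, Formula.realize_relabel, h]; simp [hj]

/-- The sentence saying that `φ` shatters some tuple of length `d`. -/
noncomputable def shatterSentence (φ : L.Formula (Fin n ⊕ Fin m)) (d : ℕ) : L.Sentence :=
  Formula.iExs (Fin d × Fin n)
    (Formula.iInf fun s : Set (Fin d) => (patternFormula φ s).relabel Sum.inr)

theorem realize_shatterSentence {M : Type w} [L.Structure M] (φ : L.Formula (Fin n ⊕ Fin m))
    (d : ℕ) : M ⊨ shatterSentence φ d ↔ ∃ x : Fin d → Fin n → M,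
      TupleShattered (fun x (y : Fin m → M) => φ.Realize (Sum.elim x y)) x := by
  simp only [shatterSentence, Sentence.Realize, Formula.realize_iExs, Formula.realize_iInf,
    Formula.realize_relabel, realize_patternFormula, TupleShattered]
  exact ⟨fun ⟨v, hv⟩ => ⟨fun j i => v (j, i), hv⟩, fun ⟨x, hx⟩ => ⟨fun p => x p.1 p.2, hx⟩⟩

/-- An NIP formula has bounded VC dimension, uniformly in all models of a complete theory. -/
theorem FormulaNIP.exists_vcBound {T : L.Theory} (hT : T.IsComplete)
    {φ : L.Formula (Fin n ⊕ Fin m)} (hφ : FormulaNIP T φ) :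
    ∃ d : ℕ, ∀ (M : Type w) [L.Structure M] [M ⊨ T] [Nonempty M] (x : Fin d → Fin n → M),
      ¬ TupleShattered (fun x (y : Fin m → M) => φ.Realize (Sum.elim x y)) x := by
  by_contra! hcon
  -- Completeness moves the shattered tuples of all lengths into a single model `M₀`, whose
  -- ultrapower then violates NIP.
  have hsent : ∀ d, T ⊨ᵇ shatterSentence φ d := by
    intro d
    obtain ⟨M, _, _, _, x, hx⟩ := hcon d
    exact (hT.realize_sentence_iff _ M).1 ((realize_shatterSentence φ d).2 ⟨x, hx⟩)
  obtain ⟨M₀⟩ := hT.1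
  have hx : ∀ d, ∃ x : Fin d → Fin n → M₀,
      TupleShattered (fun x (y : Fin m → M₀) => φ.Realize (Sum.elim x y)) x := fun d =>
    (realize_shatterSentence φ d).1 ((hsent d).realize_sentence M₀)
  choose x hx using hx
  choose y hy using hx
  let U : Ultrafilter ℕ := Filter.hyperfilter ℕ
  let M : Type (max u v) := (U : Filter ℕ).Product fun _ => (M₀ : Type (max u v))
  have hM : M ⊨ T := ⟨fun ψ hψ => (Ultraproduct.sentence_realize ψ).2
    (Filter.Eventually.of_forall fun _ => M₀.is_model.realize_of_mem ψ hψ)⟩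
  let c : M₀ := Classical.choice inferInstance
  -- At stage `d` only the points `t < d` exist; the default `c` is used at finitely many stages,
  -- which the ultrafilter ignores.
  let a : ℕ → Fin n → ℕ → M₀ := fun t i d => if h : t < d then x d ⟨t, h⟩ i else c
  let b : Set ℕ → Fin m → ℕ → M₀ := fun s i d => y d {j | (j : ℕ) ∈ s} i
  refine hφ ⟨Theory.ModelType.of T M, fun t i => ((a t i : ℕ → M₀) : M),
    fun s i => ((b s i : ℕ → M₀) : M), fun t s => ?_⟩
  have h : (Sum.elim (fun i => ((a t i : ℕ → M₀) : M)) (fun i => ((b s i : ℕ → M₀) : M))) =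
      fun i => ((Sum.elim (a t) (b s) i : ℕ → M₀) : M) := by
    funext i; rcases i with i | i <;> rfl
  have h2 : φ.Realize (fun i => ((Sum.elim (a t) (b s) i : ℕ → M₀) : M)) ↔ t ∈ s := by
    rw [Ultraproduct.realize_formula_cast]
    have hev : ∀ᶠ d in (U : Filter ℕ),
        (φ.Realize (fun i => Sum.elim (a t) (b s) i d) ↔ t ∈ s) := by
      have : ∀ᶠ d in (U : Filter ℕ), t < d :=
        Nat.hyperfilter_le_atTop (Filter.eventually_gt_atTop t)
      filter_upwards [this] with d hd
      have := hy d {j | (j : ℕ) ∈ s} ⟨t, hd⟩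
      have h3 : (fun i => Sum.elim (a t) (b s) i d) =
          Sum.elim (x d ⟨t, hd⟩) (y d {j | (j : ℕ) ∈ s}) := by
        funext i; rcases i with i | i <;> simp [a, b, hd]
      rw [h3]; exact this
    rw [Filter.eventually_congr hev, Filter.eventually_const]
  exact (iff_of_eq (congrArg φ.Realize h)).trans h2

end HonestDefinitions

/-! ### Separating conjunctions in an ultraproduct -/

section

open Filter

/-- The pattern `s` on the tuple `x` is cut out by some `R · y`. -/
def HasPattern {X Y : Type*} (R : X → Y → Prop) {d : ℕ} (s : Set (Fin d)) (x : Fin d → X) :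
    Prop :=
  ∃ y, ∀ j, R (x j) y ↔ j ∈ s

/-- Countable saturation by diagonalization: at index `i`, choose a point meeting the longest
satisfiable initial segment of conditions of length at most `i`. -/
theorem exists_diagonal {W : Ultrafilter ℕ} (hW : (W : Filter ℕ) ≤ atTop) {X : ℕ → Type*}
    [∀ i, Nonempty (X i)] (C : ℕ → ∀ i, X i → Prop)
    (h : ∀ k, ∀ᶠ i in (W : Filter ℕ), ∃ x, ∀ l < k, C l i x) :
    ∃ c : ∀ i, X i, ∀ l, ∀ᶠ i in (W : Filter ℕ), C l i (c i) := by
  classical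
  have hc : ∀ i, ∃ x : X i, ∀ k ≤ i, (∃ x, ∀ l < k, C l i x) → ∀ l < k, C l i x := by
    intro i
    have h0 : ∃ x : X i, ∀ l < 0, C l i x := ⟨Classical.arbitrary _, by simp⟩
    obtain ⟨x, hx⟩ := Nat.findGreatest_spec (P := fun k => ∃ x : X i, ∀ l < k, C l i x)
      (Nat.zero_le i) h0
    exact ⟨x, fun k hk hP l hl => hx l (hl.trans_le (Nat.le_findGreatest hk hP))⟩
  choose c hc using hc
  refine ⟨c, fun l => ?_⟩
  filter_upwards [h (l + 1), hW (eventually_ge_atTop (l + 1))] with i hi hil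
  exact hc i (l + 1) hil hi l (Nat.lt_succ_self l)

/-- Ultraproducts over `ℕ` realize countable types. -/
theorem exists_realization {W : Ultrafilter ℕ} (hW : (W : Filter ℕ) ≤ atTop) {X : ℕ → Type*}
    [∀ i, Nonempty (X i)] {Λ : Type*} [Countable Λ] (B : ∀ i, X i → Prop)
    (C : Λ → ∀ i, X i → Prop)
    (h : ∀ F : Finset Λ, ∀ᶠ i in (W : Filter ℕ), ∃ x, B i x ∧ ∀ l ∈ F, C l i x) :
    ∃ c : ∀ i, X i, (∀ᶠ i in (W : Filter ℕ), B i (c i)) ∧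
      ∀ l, ∀ᶠ i in (W : Filter ℕ), C l i (c i) := by
  obtain ⟨f, hf⟩ := exists_injective_nat Λ
  -- `B` is attached to every condition, so stage `0` yields it even when `Λ` is empty.
  obtain ⟨c, hc⟩ := exists_diagonal hW (X := X)
    (fun l i x => B i x ∧ ∀ k, f k = l → C k i x) (fun n => by
      have hfin : {k | f k < n}.Finite := (Set.finite_lt_nat n).preimage hf.injOn
      filter_upwards [h hfin.toFinset] with i ⟨x, hx, hx'⟩
      exact ⟨x, fun l hl => ⟨hx, fun k hk => hx' k (by simpa [hk] using hl)⟩⟩)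
  exact ⟨c, (hc 0).mono fun i hi => hi.1, fun l => (hc (f l)).mono fun i hi => hi.2 l rfl⟩

/-- The tuple equal to `c` below `t` and to `D ∘ k` from `t` on. -/
def mixTuple {N : ℕ} {E ι : Type*} (D : ι → E) (c : Fin N → E) (t : ℕ) (k : Fin N → ι) :
    Fin N → E :=
  fun j => if (j : ℕ) < t then c j else D (k j)

theorem update_eval {N : ℕ} {X : ℕ → Type*} (e : Fin N → ∀ i, X i) (t : Fin N) (x : ∀ i, X i)
    (i : ℕ) : (fun j => Function.update e t x j i) = Function.update (fun j => e j i) t (x i) := by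
  funext j
  simp only [Function.update_apply]
  split_ifs <;> rfl

theorem mixTuple_update {N : ℕ} {E ι : Type*} (D : ι → E) (c : Fin N → E) (t : Fin N)
    (x : E) (k : Fin N → ι) {r : ℕ} (hr : r ≤ t) :
    mixTuple D (Function.update c t x) r k = mixTuple D c r k := by
  funext j
  simp only [mixTuple, Function.update_apply]
  split_ifs with h1 h2
  · subst h2; omega
  · rfl
  · rfl

theorem mixTuple_succ {N : ℕ} {E ι : Type*} (D : ι → E) (c : Fin N → E) (t : Fin N)
    (k : Fin N → ι) :
    mixTuple D c (t + 1) k = Function.update (mixTuple D c t k) t (c t) := by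
  funext j
  simp only [mixTuple, Function.update_apply]
  by_cases h : j = t
  · subst h; simp
  · have : (j : ℕ) ≠ t := fun h' => h (Fin.ext h')
    simp only [h, if_false]
    congr 1
    simp only [eq_iff_iff]; omega

theorem mixTuple_update_index {N : ℕ} {E ι : Type*} (D : ι → E) (c : Fin N → E) (t : Fin N)
    (k : Fin N → ι) (k' : ι) :
    mixTuple D c t (Function.update k t k') = Function.update (mixTuple D c t k) t (D k') := by
  funext j
  simp only [mixTuple, Function.update_apply]
  by_cases h : j = t
  · subst h; simp
  · simp [h]

section Ultraproduct

variable {W : Ultrafilter ℕ} {X Y : ℕ → Type*} {R : ∀ i, X i → Y i → Prop} {A : ∀ i, Set (X i)}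
  {a : ∀ i, Y i} {N : ℕ} {ι : Type*} {D : ι → ∀ i, X i} {U : Ultrafilter ι}

/-- If no conjunction of negated patterns separates the `U`-generic element of `D` from the
complement of `R · a`, then the generic element is imitated by a tuple on which `R · a` cuts out an
arbitrary pattern. -/
theorem exists_imitation (hW : (W : Filter ℕ) ≤ atTop) [∀ i, Nonempty (X i)] [Countable ι]
    (hD : ∀ k, ∀ᶠ i in (W : Filter ℕ), D k i ∈ A i ∧ R i (D k i) (a i))
    (hn : ∀ l : List ((Set (Fin N) × Fin N) × (Fin N → ∀ i, X i)),
      (∀ p ∈ l, ∀ j, ∀ᶠ i in (W : Filter ℕ), p.2 j i ∈ A i) →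
      (∀ᶠ k in (U : Filter ι), ∀ᶠ i in (W : Filter ℕ), ∀ p ∈ l,
        ¬ HasPattern (R i) p.1.1 (Function.update (fun j => p.2 j i) p.1.2 (D k i))) →
      ¬ ∀ᶠ i in (W : Filter ℕ), ∀ x ∈ A i, (∀ p ∈ l,
        ¬ HasPattern (R i) p.1.1 (Function.update (fun j => p.2 j i) p.1.2 x)) → R i x (a i))
    (s : Set (Fin N)) (t : ℕ) (ht : t ≤ N) :
    ∃ c : Fin N → ∀ i, X i,
      (∀ j : Fin N, (j : ℕ) < t → ∀ᶠ i in (W : Filter ℕ),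
        c j i ∈ A i ∧ (R i (c j i) (a i) ↔ j ∈ s)) ∧
      ∀ j : Fin N, (j : ℕ) < t → ∀ k : Fin N → ι,
        (∀ᶠ k' in (U : Filter ι), ¬ ∀ᶠ i in (W : Filter ℕ), HasPattern (R i) s
          fun j' => Function.update (mixTuple D c j k) j (D k') j' i) →
        ¬ ∀ᶠ i in (W : Filter ℕ), HasPattern (R i) s
          fun j' => Function.update (mixTuple D c j k) j (c j) j' i := by
  induction t with
  | zero => exact ⟨fun _ i => Classical.arbitrary _, by simp, by simp⟩
  | succ r ih =>
    obtain ⟨c, hcA, hc⟩ := ih (by omega)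
    let t : Fin N := ⟨r, by omega⟩
    -- The new entry must avoid every pattern that `U`-generically fails over the earlier entries
    -- and `D`. There are countably many such requirements.
    let Λ := {k : Fin N → ι // ∀ᶠ k' in (U : Filter ι), ¬ ∀ᶠ i in (W : Filter ℕ),
      HasPattern (R i) s fun j' => Function.update (mixTuple D c t k) t (D k') j' i}
    obtain ⟨x, hxA, hx⟩ := exists_realization hW (Λ := Λ)
      (fun i x => x ∈ A i ∧ (R i x (a i) ↔ t ∈ s))
      (fun k i x => ¬ HasPattern (R i) s
        (Function.update (fun j => mixTuple D c t k.1 j i) t x)) (fun F => by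
        have hF : ∀ᶠ k' in (U : Filter ι), ∀ᶠ i in (W : Filter ℕ), ∀ k ∈ F,
            ¬ HasPattern (R i) s
              (Function.update (fun j => mixTuple D c t k.1 j i) t (D k' i)) := by
          have : ∀ᶠ k' in (U : Filter ι), ∀ k ∈ F, ¬ ∀ᶠ i in (W : Filter ℕ),
              HasPattern (R i) s fun j' =>
                Function.update (mixTuple D c t k.1) t (D k') j' i :=
            (eventually_all_finset F).2 fun k _ => k.2
          filter_upwards [this] with k' hk'
          refine (eventually_all_finset F).2 fun k hk => ?_
          have := Ultrafilter.eventually_not.2 (hk' k hk)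
          simpa only [update_eval] using this
        -- For `t ∈ s` a generic element of `D` itself serves; for `t ∉ s` the failure of separation
        -- supplies a point of `A` outside `R · a`.
        by_cases hts : t ∈ s
        · obtain ⟨k', hk'⟩ := hF.exists
          filter_upwards [hk', hD k'] with i h1 h2
          exact ⟨D k' i, ⟨h2.1, by simp [h2.2, hts]⟩, h1⟩
        · have := Ultrafilter.eventually_not.2
            (hn (F.toList.map fun k => ((s, t), mixTuple D c t k.1)) (by
              simp only [List.mem_map, Finset.mem_toList]
              rintro _ ⟨k, -, rfl⟩ j
              simp only [mixTuple]
              split_ifs with h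
              · exact (hcA j h).mono fun i hi => hi.1
              · exact (hD _).mono fun i hi => hi.1) (by
              filter_upwards [hF] with k' hk'
              filter_upwards [hk'] with i hi
              simp only [List.mem_map, Finset.mem_toList]
              rintro _ ⟨k, hk, rfl⟩
              exact hi k hk))
          filter_upwards [this] with i hi
          push Not at hi
          obtain ⟨x, hxA, hx, hxR⟩ := hi
          refine ⟨x, ⟨hxA, by simp [hxR, hts]⟩, fun k hk => hx ((s, t), mixTuple D c t k.1) ?_⟩
          exact List.mem_map.2 ⟨k, Finset.mem_toList.2 hk, rfl⟩)
    have hlt : ∀ j : Fin N, (j : ℕ) < r + 1 → j ≠ t → (j : ℕ) < r := fun j hj hjt => by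
      have : (j : ℕ) ≠ r := fun h => hjt (Fin.ext h)
      omega
    refine ⟨Function.update c t x, fun j hj => ?_, fun j hj k hk => ?_⟩
    · by_cases hjt : j = t
      · subst hjt; simpa using hxA
      · simpa [hjt] using hcA j (hlt j hj hjt)
    · rw [mixTuple_update D c t x k (show (j : ℕ) ≤ t from Nat.lt_succ_iff.1 hj)] at hk ⊢
      by_cases hjt : j = t
      · subst hjt
        have := hx ⟨k, hk⟩
        rw [← Ultrafilter.eventually_not]
        simpa only [update_eval, Function.update_self] using this
      · rw [Function.update_of_ne hjt]
        exact hc j (hlt j hj hjt) k hk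

/-- Otherwise each `s` has an imitating tuple on which `a` cuts out `s`. Exchanging the entries for
elements of `D` keeps every pattern and ends in a shattered tuple of `D`. -/
theorem exists_separating_conjunction (hW : (W : Filter ℕ) ≤ atTop) [∀ i, Nonempty (X i)]
    [Countable ι] (hVC : ∀ i (x : Fin N → X i), ¬ TupleShattered (R i) x)
    (hD : ∀ k, ∀ᶠ i in (W : Filter ℕ), D k i ∈ A i ∧ R i (D k i) (a i)) :
    ∃ l : List ((Set (Fin N) × Fin N) × (Fin N → ∀ i, X i)),
      (∀ p ∈ l, ∀ j, ∀ᶠ i in (W : Filter ℕ), p.2 j i ∈ A i) ∧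
      (∀ᶠ k in (U : Filter ι), ∀ᶠ i in (W : Filter ℕ), ∀ p ∈ l,
        ¬ HasPattern (R i) p.1.1 (Function.update (fun j => p.2 j i) p.1.2 (D k i))) ∧
      ∀ᶠ i in (W : Filter ℕ), ∀ x ∈ A i, (∀ p ∈ l,
        ¬ HasPattern (R i) p.1.1 (Function.update (fun j => p.2 j i) p.1.2 x)) → R i x (a i) := by
  by_contra hcon
  have hn := exists_imitation (U := U) hW hD
    (fun l h1 h2 h3 => hcon ⟨l, h1, h2, h3⟩)
  choose! c hcA hc using fun s => hn s N le_rfl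
  -- The last `r` entries already come from `D`, through indices `k` common to all `s`.
  have key : ∀ r ≤ N, ∃ k : Fin N → ι, ∀ s, ∀ᶠ i in (W : Filter ℕ),
      HasPattern (R i) s fun j => mixTuple D (c s) (N - r) k j i := by
    intro r hr
    induction r with
    | zero =>
      obtain ⟨k₀, -⟩ := U.nonempty_of_mem univ_mem
      refine ⟨fun _ => k₀, fun s => ?_⟩
      filter_upwards [eventually_all.2 fun j : Fin N => hcA s j j.2] with i hi
      refine ⟨a i, fun j => ?_⟩
      simpa [mixTuple] using (hi j).2
    | succ r ih =>
      obtain ⟨k, hk⟩ := ih (by omega)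
      let t : Fin N := ⟨N - (r + 1), by omega⟩
      have hU : ∀ᶠ k' in (U : Filter ι), ∀ s, ∀ᶠ i in (W : Filter ℕ),
          HasPattern (R i) s fun j => Function.update (mixTuple D (c s) t k) t (D k') j i := by
        refine eventually_all.2 fun s => ?_
        have h1 : N - r = (t : ℕ) + 1 := by simp only [t]; omega
        have h2 := hk s
        -- The pattern holds with the imitation at place `t`, so it cannot fail generically. As
        -- there are finitely many `s`, one `k'` works for all.
        rw [h1, mixTuple_succ] at h2
        have h3 := mt (hc s t t.2 k) (not_not.2 h2)
        rw [← Ultrafilter.eventually_not] at h3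
        simpa only [not_not] using h3
      obtain ⟨k', hk'⟩ := hU.exists
      refine ⟨Function.update k t k', fun s => ?_⟩
      have := hk' s
      rwa [← mixTuple_update_index] at this
  obtain ⟨k, hk⟩ := key N le_rfl
  obtain ⟨i, hi⟩ := (eventually_all.2 hk).exists
  exact hVC i (fun j => D (k j) i) fun s => by simpa [mixTuple, HasPattern] using hi s

end Ultraproduct

end

/-! ### Honest definitions of bounded shape -/

section

open Filter

/-- `x` satisfies a disjunction of conjunctions of negated patterns, where each `p` stands for
the pattern `p.1.1` on the tuple `p.2` with its entry at `p.1.2` replaced by `x`. -/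
def SatisfiesDNF {X Y : Type*} (R : X → Y → Prop) {N : ℕ}
    (θ : List (List ((Set (Fin N) × Fin N) × (Fin N → X)))) (x : X) : Prop :=
  ∃ c ∈ θ, ∀ p ∈ c, ¬ HasPattern R p.1.1 (Function.update p.2 p.1.2 x)

/-- Compactness of the space of ultrafilters: without a finite cover, the complements of the `S l`
have the finite intersection property and lie in a common ultrafilter. -/
theorem exists_list_cover_of_ultrafilter {ι α : Type*} (G : Set α) (S : α → Set ι)
    (h : ∀ U : Ultrafilter ι, ∃ l ∈ G, ∀ᶠ k in (U : Filter ι), k ∈ S l) :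
    ∃ Θ : List α, (∀ l ∈ Θ, l ∈ G) ∧ ∀ k, ∃ l ∈ Θ, k ∈ S l := by
  classical
  by_contra! hcon
  obtain ⟨U, hU⟩ := Ultrafilter.exists_ultrafilter_of_finite_inter_nonempty ((fun l => (S l)ᶜ) '' G)
    (fun T hT => by
      obtain ⟨T', hT', rfl⟩ := Finset.subset_set_image_iff.1 hT
      obtain ⟨k, hk⟩ := hcon T'.toList (fun l hl => hT' (by simpa using hl))
      refine ⟨k, ?_⟩
      simpa using hk)
  obtain ⟨l, hl, hlU⟩ := h U
  have h2 : ∀ᶠ k in (U : Filter ι), k ∈ (S l)ᶜ := hU ⟨l, hl, rfl⟩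
  obtain ⟨k, hk1, hk2⟩ := (hlU.and h2).exists
  exact hk2 hk1

/-- Relations without shattered `N`-tuples admit honest definitions of bounded shape for the sets
`{x ∈ A | R x a}`, where `q` bounds the number of points that have to be covered. -/
theorem exists_honest_shapes (N : ℕ) (q : List (List (Set (Fin N) × Fin N)) → ℕ) :
    ∃ F : Finset (List (List (Set (Fin N) × Fin N))),
      ∀ (X Y : Type w) (R : X → Y → Prop) (A : Set X) (a : Y), Nonempty X →
        (∀ x : Fin N → X, ¬ TupleShattered R x) →
        ∃ σ ∈ F, ∀ f : Fin (q σ) → X, (∀ l, f l ∈ A ∧ R (f l) a) →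
          ∃ θ : List (List ((Set (Fin N) × Fin N) × (Fin N → X))),
            θ.map (List.map Prod.fst) = σ ∧ (∀ c ∈ θ, ∀ p ∈ c, ∀ j, p.2 j ∈ A) ∧
            (∀ l, SatisfiesDNF R θ (f l)) ∧ ∀ x ∈ A, SatisfiesDNF R θ x → R x a := by
  classical
  by_contra! hcon
  obtain ⟨e, he⟩ := exists_injective_nat (List (List (Set (Fin N) × Fin N)))
  have hfin : ∀ i, {σ | e σ ≤ i}.Finite := fun i => (Set.finite_le_nat i).preimage he.injOn
  -- The `i`-th counterexample defeats every shape with code at most `i`.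
  choose X Y R A a hX hVC f hfA hf using fun i => hcon (hfin i).toFinset
  have hmem : ∀ {σ i}, e σ ≤ i → σ ∈ (hfin i).toFinset := fun h => by simpa using h
  let W : Ultrafilter ℕ := hyperfilter ℕ
  have hW : (W : Filter ℕ) ≤ atTop := Nat.hyperfilter_le_atTop
  -- The bad points of all shapes are collected at once, since the shape that will be contradicted
  -- is known only after `Θ` is found.
  let D : (Σ σ, Fin (q σ)) → ∀ i, X i := fun k i =>
    if h : e k.1 ≤ i then f i k.1 (hmem h) k.2 else Classical.arbitrary _
  have hD : ∀ k, ∀ᶠ i in (W : Filter ℕ), D k i ∈ A i ∧ R i (D k i) (a i) := fun k => by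
    filter_upwards [hW (eventually_ge_atTop (e k.1))] with i hi
    simp only [D, dif_pos hi]
    exact hfA i _ _ _
  obtain ⟨Θ, hΘ, hcov⟩ := exists_list_cover_of_ultrafilter
    {l : List ((Set (Fin N) × Fin N) × (Fin N → ∀ i, X i)) |
      (∀ p ∈ l, ∀ j, ∀ᶠ i in (W : Filter ℕ), p.2 j i ∈ A i) ∧
      ∀ᶠ i in (W : Filter ℕ), ∀ x ∈ A i, (∀ p ∈ l,
        ¬ HasPattern (R i) p.1.1 (Function.update (fun j => p.2 j i) p.1.2 x)) → R i x (a i)}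
    (fun l => {k | ∀ᶠ i in (W : Filter ℕ), ∀ p ∈ l,
      ¬ HasPattern (R i) p.1.1 (Function.update (fun j => p.2 j i) p.1.2 (D k i))})
    (fun U => by
      obtain ⟨l, h1, h2, h3⟩ := exists_separating_conjunction (U := U) hW hVC hD
      exact ⟨l, ⟨h1, h3⟩, h2⟩)
  let σ : List (List (Set (Fin N) × Fin N)) := Θ.map (List.map Prod.fst)
  have hpar : ∀ᶠ i in (W : Filter ℕ), ∀ l ∈ Θ, ∀ p ∈ l, ∀ j, p.2 j i ∈ A i :=
    (eventually_all_finite Θ.finite_toSet).2 fun l hl =>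
      (eventually_all_finite l.finite_toSet).2 fun p hp =>
        eventually_all.2 fun j => (hΘ l hl).1 p hp j
  have hsep : ∀ᶠ i in (W : Filter ℕ), ∀ l ∈ Θ, ∀ x ∈ A i, (∀ p ∈ l,
      ¬ HasPattern (R i) p.1.1 (Function.update (fun j => p.2 j i) p.1.2 x)) → R i x (a i) :=
    (eventually_all_finite Θ.finite_toSet).2 fun l hl => (hΘ l hl).2
  have hcv : ∀ᶠ i in (W : Filter ℕ), ∀ k : Fin (q σ), ∃ l ∈ Θ, ∀ p ∈ l,
      ¬ HasPattern (R i) p.1.1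
        (Function.update (fun j => p.2 j i) p.1.2 (D ⟨σ, k⟩ i)) :=
    eventually_all.2 fun k => by
      obtain ⟨l, hl, h⟩ := hcov ⟨σ, k⟩
      exact h.mono fun i hi => ⟨l, hl, hi⟩
  obtain ⟨i, hpar, hsep, hcv, hi⟩ :=
    (hpar.and (hsep.and (hcv.and (hW (eventually_ge_atTop (e σ)))))).exists
  let θ := Θ.map (List.map fun p => (p.1, fun j => p.2 j i))
  have hθ : ∀ x, SatisfiesDNF (R i) θ x ↔ ∃ l ∈ Θ, ∀ p ∈ l,
      ¬ HasPattern (R i) p.1.1 (Function.update (fun j => p.2 j i) p.1.2 x) := fun x => by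
    simp [SatisfiesDNF, θ]
  obtain ⟨x, hxA, hx, hxR⟩ := hf i σ (hmem hi) θ
    (by simp [θ, σ, Function.comp_def])
    (by
      simp only [θ, List.mem_map]
      rintro _ ⟨l, hl, rfl⟩ p hp
      obtain ⟨p', hp', rfl⟩ := List.mem_map.1 hp
      exact hpar l hl p' hp')
    (fun k => (hθ _).2 (by simpa [D, dif_pos hi] using hcv k))
  obtain ⟨l, hl, h⟩ := (hθ x).1 hx
  exact hxR (hsep l hl x hxA h)

end

/-! ### Sauer–Shelah and the ε-net theorem -/

open Finset in
theorem sum_choose_le_pow (M d : ℕ) : ∑ k ∈ Iic d, M.choose k ≤ (M + 1) ^ d := by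
  rw [add_pow]
  have : Iic d = range (d + 1) := by ext; simp
  rw [this]
  refine sum_le_sum fun k hk => ?_
  have h1 : 1 ≤ d.choose k := Nat.choose_pos (Nat.lt_succ_iff.1 (mem_range.1 hk))
  calc M.choose k ≤ M ^ k := Nat.choose_le_pow M k
    _ ≤ M ^ k * 1 ^ (d - k) * d.choose k := by
      rw [one_pow, mul_one]; exact Nat.le_mul_of_pos_right _ h1

open Finset in
/-- The **Sauer–Shelah lemma** for the traces of a relation on a finite family of points. -/
theorem card_traces_le {X B : Type*} {R : X → B → Prop} {d : ℕ}
    (hR : ∀ x : Fin d → X, ¬ TupleShattered R x) {κ : Type*} [Fintype κ] [DecidableEq κ]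
    (z : κ → X) (G : Finset (Finset κ)) (hG : ∀ T ∈ G, ∃ b, ∀ p, p ∈ T ↔ R (z p) b) :
    #G ≤ (Fintype.card κ + 1) ^ d := by
  have hvc : G.vcDim ≤ d := by
    refine Finset.sup_le fun s hs => ?_
    rw [mem_shatterer] at hs
    by_contra! hlt
    obtain ⟨s', hs', hcard⟩ := exists_subset_card_eq hlt.le
    have hsh := hs.mono_right hs'
    let e : Fin d ≃ s' := (finCongr hcard.symm).trans s'.equivFin.symm
    refine hR (fun j => z (e j)) fun t => ?_
    classical
    obtain ⟨T, hT, hTt⟩ := hsh (t := s'.filter fun p => ∃ j ∈ t, (e j : κ) = p)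
      (filter_subset _ _)
    obtain ⟨b, hb⟩ := hG T hT
    refine ⟨b, fun j => ?_⟩
    rw [← hb]
    have h1 : (e j : κ) ∈ T ↔ (e j : κ) ∈ s' ∩ T := by simp
    rw [h1, hTt, mem_filter]
    constructor
    · rintro ⟨-, j', hj', h⟩
      rwa [← e.injective (Subtype.ext h)]
    · exact fun h => ⟨(e j).2, j, h, rfl⟩
  calc #G ≤ #G.shatterer := card_le_card_shatterer G
    _ ≤ ∑ k ∈ Iic G.vcDim, (Fintype.card κ).choose k := card_shatterer_le_sum_vcDim
    _ ≤ ∑ k ∈ Iic d, (Fintype.card κ).choose k :=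
      sum_le_sum_of_subset (Iic_subset_Iic.2 hvc)
    _ ≤ _ := sum_choose_le_pow _ _

open Finset in
/-- If half of a family of pairs is chosen at random, then it is unlikely that the chosen half
misses a set met by the other half at least `k` times. -/
theorem card_swaps_le {N : ℕ} (T : Finset (Fin N × Bool)) (k : ℕ) :
    #{σ : Fin N → Bool | (∀ j, (j, σ j) ∉ T) ∧ k ≤ #{j | (j, !σ j) ∈ T}} ≤ 2 ^ (N - k) := by
  rcases eq_empty_or_nonempty
    ({σ : Fin N → Bool | (∀ j, (j, σ j) ∉ T) ∧ k ≤ #{j | (j, !σ j) ∈ T}} :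
      Finset (Fin N → Bool)) with h | ⟨σ₀, h₀⟩
  · rw [h]; simp
  obtain ⟨-, hmiss₀, hk⟩ := mem_filter.1 h₀
  set J : Finset (Fin N) := {j | (j, !σ₀ j) ∈ T} with hJ
  -- On `J` the point opposite to `σ₀ j` lies in `T`, so no admissible `σ` may choose it; only the
  -- coordinates off `J` remain free.
  have hagree : ∀ σ : Fin N → Bool, (∀ j, (j, σ j) ∉ T) → ∀ j ∈ J, σ j = σ₀ j := by
    intro σ hσ j hj
    by_contra hne
    have : σ j = !σ₀ j := by cases h1 : σ j <;> cases h2 : σ₀ j <;> simp_all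
    exact hσ j (this ▸ (mem_filter.1 hj).2)
  calc _ ≤ #(univ : Finset ({j // j ∉ J} → Bool)) := by
        refine card_le_card_of_injOn (fun σ j => σ j.1) (fun _ _ => mem_univ _) ?_
        intro σ hσ τ hτ hστ
        have h1 := (mem_filter.1 hσ).2.1
        have h2 := (mem_filter.1 hτ).2.1
        funext j
        by_cases hj : j ∈ J
        · rw [hagree σ h1 j hj, hagree τ h2 j hj]
        · exact congrFun hστ ⟨j, hj⟩
    _ = 2 ^ (N - #J) := by
        rw [card_univ, Fintype.card_fun, Fintype.card_bool]
        congr 1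
        simp [Fintype.card_subtype_compl]
    _ ≤ 2 ^ (N - k) := Nat.pow_le_pow_right (by norm_num) (by omega)

/-- Choosing one point of each pair splits a family of pairs into two families. -/
def splitEquiv {N : ℕ} (D : Type*) (σ : Fin N → Bool) :
    (Fin N × Bool → D) ≃ (Fin N → D) × (Fin N → D) where
  toFun z := (fun j => z (j, σ j), fun j => z (j, !σ j))
  invFun y p := if p.2 = σ p.1 then y.1 p.1 else y.2 p.1
  left_inv z := by
    funext ⟨j, b⟩
    by_cases h : b = σ j
    · simp [h]
    · have : (!σ j) = b := by cases b <;> cases h' : σ j <;> simp_all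
      simp [h, this]
  right_inv y := by
    ext j <;> simp

section Weights

variable {D : Type*} {μ : D → ℝ}

theorem sum_prod_weights [Fintype D] (hμ : ∑ x, μ x = 1) (N : ℕ) :
    ∑ x : Fin N → D, ∏ j, μ (x j) = 1 := by
  classical
  have := Finset.prod_univ_sum (fun _ : Fin N => (Finset.univ : Finset D)) fun _ x => μ x
  rw [Fintype.piFinset_univ] at this
  rw [← this]; simp [hμ]

theorem sum_prod_weights_mul [Fintype D] (hμ : ∑ x, μ x = 1) {N : ℕ} (j : Fin N) (g : D → ℝ) :
    ∑ x : Fin N → D, (∏ i, μ (x i)) * g (x j) = ∑ x, μ x * g x := by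
  classical
  have := Finset.prod_univ_sum (fun _ : Fin N => (Finset.univ : Finset D))
    fun i x => μ x * if i = j then g x else 1
  rw [Fintype.piFinset_univ] at this
  calc _ = ∑ x : Fin N → D, ∏ i, (μ (x i) * if i = j then g (x i) else 1) := by
        refine Finset.sum_congr rfl fun x _ => ?_
        rw [Finset.prod_mul_distrib, Finset.prod_ite_eq' Finset.univ j fun i => g (x i)]
        simp
    _ = _ := by
        rw [← this, Finset.prod_eq_single_of_mem j (Finset.mem_univ j)]
        · simp
        · intro i _ hij; simp [hij, hμ]

theorem prod_weights_split {N : ℕ} (σ : Fin N → Bool) (z : Fin N × Bool → D) :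
    ∏ p, μ (z p) = (∏ j, μ (z (j, σ j))) * ∏ j, μ (z (j, !σ j)) := by
  rw [Fintype.prod_prod_type, ← Finset.prod_mul_distrib]
  refine Finset.prod_congr rfl fun j _ => ?_
  cases σ j <;> simp [mul_comm]

end Weights

theorem exists_mul_pow_lt_two_pow (d : ℕ) : ∃ k : ℕ, 4 * (8 * k + 1) ^ d < 2 ^ k := by
  have h := tendsto_pow_const_div_const_pow_of_one_lt d (r := (2 : ℝ)) (by norm_num)
  have hpos : (0 : ℝ) < 1 / (4 * 9 ^ d) := by positivity
  obtain ⟨k, hk, hk1⟩ := ((h.eventually (gt_mem_nhds hpos)).and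
    (Filter.eventually_ge_atTop 1)).exists
  refine ⟨k, ?_⟩
  rw [div_lt_div_iff₀ (by positivity) (by positivity), one_mul] at hk
  have h1 : (8 * k + 1) ^ d ≤ (9 * k) ^ d := Nat.pow_le_pow_left (by omega) d
  have h2 : ((k ^ d * (4 * 9 ^ d) : ℕ) : ℝ) < ((2 ^ k : ℕ) : ℝ) := by exact_mod_cast hk
  calc 4 * (8 * k + 1) ^ d ≤ 4 * (9 * k) ^ d := by gcongr
    _ = k ^ d * (4 * 9 ^ d) := by rw [mul_pow]; ring
    _ < 2 ^ k := by exact_mod_cast h2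

open Finset in
/-- The number of swaps after which a set from a family `G` is missed by the first half of the
points but met often by the second one. -/
theorem card_bad_swaps_le {X B : Type*} {R : X → B → Prop} {d : ℕ}
    (hR : ∀ x : Fin d → X, ¬ TupleShattered R x) {N : ℕ} (k : ℕ) (z : Fin N × Bool → X)
    (b : (Fin N → Bool) → B) (hb : ∀ σ j, ¬ R (z (j, σ j)) (b σ)) [∀ x y, Decidable (R x y)] :
    #{σ : Fin N → Bool | k ≤ #{j | R (z (j, !σ j)) (b σ)}} ≤ (2 * N + 1) ^ d * 2 ^ (N - k) := by
  classical
  let tr : B → Finset (Fin N × Bool) := fun b => {p | R (z p) b}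
  let G : Finset (Finset (Fin N × Bool)) := univ.image fun σ => tr (b σ)
  have hG : #G ≤ (2 * N + 1) ^ d := by
    have := card_traces_le hR z G (fun T hT => by
      obtain ⟨σ, -, rfl⟩ := mem_image.1 hT
      exact ⟨b σ, fun p => by simp [tr]⟩)
    simpa [mul_comm] using this
  calc _ ≤ #(G.biUnion fun T =>
        {σ : Fin N → Bool | (∀ j, (j, σ j) ∉ T) ∧ k ≤ #{j | (j, !σ j) ∈ T}}) := by
        refine card_le_card fun σ hσ => ?_
        rw [mem_biUnion]
        refine ⟨tr (b σ), mem_image_of_mem _ (mem_univ _), ?_⟩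
        simpa [tr, hb] using hσ
    _ ≤ #G * 2 ^ (N - k) := card_biUnion_le_card_mul _ _ _ fun T _ => card_swaps_le T k
    _ ≤ _ := Nat.mul_le_mul_right _ hG

open Finset in
/-- The **ε-net theorem** of Haussler and Welzl for finite probability spaces, with `ε = 1/2`. -/
theorem exists_half_net (d : ℕ) : ∃ N : ℕ, ∀ (D B : Type w) [Fintype D] (R : D → B → Prop)
    [∀ x y, Decidable (R x y)] (_ : ∀ x : Fin d → D, ¬ TupleShattered R x)
    (μ : D → ℝ) (_ : ∀ x, 0 ≤ μ x) (_ : ∑ x, μ x = 1),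
    ∃ x : Fin N → D, ∀ b, 1 / 2 ≤ ∑ z, μ z * (if R z b then 1 else 0) → ∃ j, R (x j) b := by
  obtain ⟨k, hk⟩ := exists_mul_pow_lt_two_pow d
  refine ⟨4 * k, fun D B _ R _ hR μ hμ0 hμ1 => ?_⟩
  -- Double sampling: every sample `x` misses some heavy set `b x`. The hits of this set in a second
  -- independent sample are counted in two ways.
  by_contra! hcon
  choose b hb hbR using hcon
  let N := 4 * k
  let h : (Fin N × Bool → D) → (Fin N → Bool) → ℝ := fun z σ =>
    #{j | R (z (j, !σ j)) (b fun j => z (j, σ j))}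
  have hk1 : 1 ≤ k := by
    by_contra hlt
    have : k = 0 := by omega
    subst this
    simp at hk
  -- Given the first half, each of the `4 * k` points of the second half hits with probability at
  -- least `1/2`.
  have hlow : ∀ σ, (2 * k : ℝ) ≤ ∑ z, (∏ p, μ (z p)) * h z σ := by
    intro σ
    have h1 : ∀ z, (∏ p, μ (z p)) * h z σ = ∑ j : Fin N, (∏ p, μ (z p)) *
        (if R (z (j, !σ j)) (b fun j => z (j, σ j)) then 1 else 0) := fun z => by
      rw [← mul_sum]
      simp [h, Finset.sum_boole]
    simp_rw [h1]
    rw [sum_comm]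
    have h2 : ∀ j : Fin N, (1 / 2 : ℝ) ≤ ∑ z : Fin N × Bool → D, (∏ p, μ (z p)) *
        (if R (z (j, !σ j)) (b fun j => z (j, σ j)) then 1 else 0) := by
      intro j
      have h3 : ∑ z : Fin N × Bool → D, (∏ p, μ (z p)) *
          (if R (z (j, !σ j)) (b fun j => z (j, σ j)) then 1 else 0) =
          ∑ y : (Fin N → D) × (Fin N → D), (∏ i, μ (y.1 i)) * ((∏ i, μ (y.2 i)) *
            (if R (y.2 j) (b y.1) then 1 else 0)) := by
        refine Fintype.sum_equiv (splitEquiv D σ) _ _ fun z => ?_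
        rw [prod_weights_split σ z, mul_assoc]
        rfl
      rw [h3, Fintype.sum_prod_type]
      simp_rw [← mul_sum]
      calc (1 / 2 : ℝ) = ∑ x : Fin N → D, (∏ i, μ (x i)) * (1 / 2) := by
            rw [← sum_mul, sum_prod_weights hμ1, one_mul]
        _ ≤ _ := by
            refine sum_le_sum fun x _ => mul_le_mul_of_nonneg_left ?_
              (prod_nonneg fun i _ => hμ0 _)
            rw [sum_prod_weights_mul hμ1 j fun y => if R y (b x) then (1 : ℝ) else 0]
            exact hb x
    calc (2 * k : ℝ) = ∑ _j : Fin N, (1 / 2 : ℝ) := by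
          simp [N]; ring
      _ ≤ _ := sum_le_sum fun j _ => h2 j
  -- For fixed `z` there are fewer than `k` hits, except for the few bad swaps, where the trivial
  -- bound `N` is used.
  have hup : ∀ z, ∑ σ, h z σ ≤ 2 ^ N * k + N * ((2 * N + 1) ^ d * 2 ^ (N - k)) := by
    intro z
    have h1 : ∀ σ, h z σ ≤ k + N * (if k ≤ #{j | R (z (j, !σ j)) (b fun j => z (j, σ j))}
        then 1 else 0) := by
      intro σ
      have hN : #{j | R (z (j, !σ j)) (b fun j => z (j, σ j))} ≤ N :=
        (card_filter_le _ _).trans (by simp)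
      simp only [h]
      split_ifs with hc
      · have : (#{j | R (z (j, !σ j)) (b fun j => z (j, σ j))} : ℝ) ≤ N := by exact_mod_cast hN
        have hk0 : (0 : ℝ) ≤ k := by positivity
        linarith
      · have : (#{j | R (z (j, !σ j)) (b fun j => z (j, σ j))} : ℝ) ≤ k := by
          exact_mod_cast (not_le.1 hc).le
        linarith
    have h2 := card_bad_swaps_le hR k z (fun σ => b fun j => z (j, σ j))
      (fun σ j => hbR (fun j => z (j, σ j)) j)
    calc ∑ σ, h z σ ≤ ∑ σ : Fin N → Bool, ((k : ℝ) +
          N * (if k ≤ #{j | R (z (j, !σ j)) (b fun j => z (j, σ j))} then 1 else 0)) :=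
          sum_le_sum fun σ _ => h1 σ
      _ = 2 ^ N * k +
          N * (#{σ : Fin N → Bool | k ≤ #{j | R (z (j, !σ j)) (b fun j => z (j, σ j))}} : ℕ) := by
          rw [sum_add_distrib, ← mul_sum, Finset.sum_boole]
          simp
      _ ≤ _ := by
          gcongr
          exact_mod_cast h2
  have hsum : (2 ^ N : ℝ) * (2 * k) ≤
      2 ^ N * k + N * ((2 * N + 1) ^ d * 2 ^ (N - k)) := by
    calc (2 ^ N : ℝ) * (2 * k) = ∑ _σ : Fin N → Bool, (2 * k : ℝ) := by simp
      _ ≤ ∑ σ : Fin N → Bool, ∑ z, (∏ p, μ (z p)) * h z σ := sum_le_sum fun σ _ => hlow σ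
      _ = ∑ z, (∏ p, μ (z p)) * ∑ σ, h z σ := by
          rw [sum_comm]; simp_rw [mul_sum]
      _ ≤ ∑ z : Fin N × Bool → D, (∏ p, μ (z p)) *
          (2 ^ N * k + N * ((2 * N + 1) ^ d * 2 ^ (N - k))) :=
          sum_le_sum fun z _ => mul_le_mul_of_nonneg_left (hup z) (prod_nonneg fun i _ => hμ0 _)
      _ = _ := by
          have h1 : ∑ z : Fin N × Bool → D, ∏ p, μ (z p) = 1 := by
            have h2 : ∑ z : Fin N × Bool → D, ∏ p, μ (z p) =
                ∑ y : (Fin N → D) × (Fin N → D), (∏ i, μ (y.1 i)) * ∏ i, μ (y.2 i) :=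
              Fintype.sum_equiv (splitEquiv D fun _ => true) _ _ fun z =>
                prod_weights_split _ z
            rw [h2, Fintype.sum_prod_type]
            simp_rw [← mul_sum, sum_prod_weights hμ1, mul_one]
            exact sum_prod_weights hμ1 N
          rw [← sum_mul, h1, one_mul]
  have hNk : (2 ^ N : ℝ) = 2 ^ k * 2 ^ (N - k) := by
    rw [← pow_add]; congr 1; omega
  have hk' : (4 * (8 * k + 1) ^ d : ℝ) < 2 ^ k := by exact_mod_cast hk
  have hN : (N : ℝ) = 4 * k := by simp [N]
  rw [hNk, hN] at hsum
  have hP : (0 : ℝ) < 2 ^ (N - k) * k := by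
    have : (0 : ℝ) < k := by exact_mod_cast hk1
    positivity
  have := mul_lt_mul_of_pos_right hk' hP
  have e1 : (2 * (4 * (k : ℝ)) + 1) = 8 * k + 1 := by ring
  rw [e1] at hsum
  nlinarith

/-! ### Minimax and bounded covers -/

open Finset in
/-- The minimax theorem for matrix games. -/
theorem exists_mixed_strategy {D B : Type*} [Fintype D] [Fintype B] [Nonempty D]
    (K : D → B → ℝ) (c : ℝ)
    (h : ∀ μ : D → ℝ, (∀ x, 0 ≤ μ x) → ∑ x, μ x = 1 → ∃ b, c ≤ ∑ x, μ x * K x b) :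
    ∃ ν : B → ℝ, (∀ b, 0 ≤ ν b) ∧ ∑ b, ν b = 1 ∧ ∀ x, c ≤ ∑ b, ν b * K x b := by
  classical
  obtain ⟨x₀⟩ := ‹Nonempty D›
  have hB : Nonempty B := by
    obtain ⟨b, -⟩ := h (Pi.single x₀ 1) (fun x => by
      by_cases hx : x = x₀ <;> simp [hx]) (by simp)
    exact ⟨b⟩
  let f : (D → ℝ) → (B → ℝ) → ℝ := fun μ ν => ∑ x, ∑ b, μ x * (ν b * K x b)
  have hlin₁ : ∀ ν, IsLinearMap ℝ fun μ => f μ ν := fun ν =>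
    ⟨fun μ μ' => by simp [f, add_mul, sum_add_distrib], fun r μ => by
      simp [f, mul_sum, mul_assoc]⟩
  have hlin₂ : ∀ μ, IsLinearMap ℝ fun ν => f μ ν := fun μ =>
    ⟨fun ν ν' => by simp [f, add_mul, mul_add, sum_add_distrib], fun r ν => by
      simp [f, mul_sum, mul_left_comm, mul_assoc]⟩
  obtain ⟨μ, hμ, ν, hν, hs⟩ := Sion.exists_isSaddlePointOn
    (X := stdSimplex ℝ D) (Y := stdSimplex ℝ B) (f := f)
    ⟨_, single_mem_stdSimplex ℝ x₀⟩ (convex_stdSimplex ℝ D) (isCompact_stdSimplex ℝ D)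
    (fun ν _ => by
      have : Continuous fun μ => f μ ν := by fun_prop
      exact this.lowerSemicontinuous.lowerSemicontinuousOn _)
    (fun ν _ => ((hlin₁ ν).mk'.convexOn (convex_stdSimplex ℝ D)).quasiconvexOn)
    (convex_stdSimplex ℝ B) ⟨_, single_mem_stdSimplex ℝ hB.some⟩ (isCompact_stdSimplex ℝ B)
    (fun μ _ => by
      have : Continuous fun ν => f μ ν := by fun_prop
      exact this.upperSemicontinuous.upperSemicontinuousOn _)
    (fun μ _ => ((hlin₂ μ).mk'.concaveOn (convex_stdSimplex ℝ B)).quasiconcaveOn)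
  refine ⟨ν, hν.1, hν.2, fun x => ?_⟩
  obtain ⟨b, hb⟩ := h μ hμ.1 hμ.2
  -- At the saddle point, the best pure reply to `μ` is worth no more than `ν` against any pure `x`.
  have h1 := hs (Pi.single x 1) (single_mem_stdSimplex ℝ x) (Pi.single b 1)
    (single_mem_stdSimplex ℝ b)
  have h2 : f μ (Pi.single b 1) = ∑ x, μ x * K x b := by simp [f, Pi.single_apply]
  have h3 : f (Pi.single x 1) ν = ∑ b, ν b * K x b := by
    simp [f, Pi.single_apply, ← mul_sum]
  rw [h2, h3] at h1
  exact hb.trans h1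

theorem TupleShattered.of_not {X Y : Type*} {R : X → Y → Prop} {d : ℕ} {x : Fin d → X}
    (h : TupleShattered (fun x y => ¬ R x y) x) : TupleShattered R x := fun s => by
  obtain ⟨y, hy⟩ := h sᶜ
  exact ⟨y, fun j => not_iff_not.1 (hy j)⟩

/-- If `R` has bounded VC dimension and dual VC dimension and any `q` points of a finite set `D`
belong to a set `R · b` with `b ∈ S`, then boundedly many sets `R · b` with `b ∈ S` cover `D`. -/
theorem exists_cover_bound (d d' : ℕ) : ∃ q N : ℕ, ∀ (X B : Type w) (R : X → B → Prop)
    (_ : ∀ x : Fin d → X, ¬ TupleShattered R x)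
    (_ : ∀ b : Fin d' → B, ¬ TupleShattered (fun b x => R x b) b)
    (D : Set X) (_ : D.Finite) (_ : D.Nonempty) (S : Set B),
    (∀ f : Fin q → X, (∀ l, f l ∈ D) → ∃ b ∈ S, ∀ l, R (f l) b) →
    ∃ g : Fin N → B, (∀ j, g j ∈ S) ∧ ∀ x ∈ D, ∃ j, R x (g j) := by
  classical
  obtain ⟨q, hq⟩ := exists_half_net.{w} d
  obtain ⟨N, hN⟩ := exists_half_net.{w} d'
  refine ⟨q, N, fun X B R hR hR' D hD hne S hS => ?_⟩
  have := hD.fintype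
  have := hne.to_subtype
  -- Only traces on the finite set `D` matter, which makes the game finite.
  let B' := {Z : Set D // ∃ b ∈ S, ∀ x : D, x ∈ Z ↔ R x b}
  choose r hrS hr using fun Z : B' => Z.2
  have hB' : ∀ b ∈ S, ∃ Z : B', ∀ x : D, R x b ↔ R x (r Z) := fun b hb => by
    let Z : B' := ⟨{x | R x b}, b, hb, fun x => Iff.rfl⟩
    exact ⟨Z, fun x => hr Z x⟩
  obtain ⟨ν, hν0, hν1, hν⟩ := exists_mixed_strategy
    (fun (x : D) (Z : B') => if R x (r Z) then (1 : ℝ) else 0) (1 / 2) fun μ hμ0 hμ1 => by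
      -- A net for the complements: if `R · b` contains all `q` points, its complement misses the
      -- net and so has weight below `1/2`.
      obtain ⟨x, hx⟩ := hq D B (fun x b => ¬ R x b)
        (fun x hx => hR (fun j => x j) hx.of_not) μ hμ0 hμ1
      obtain ⟨b, hb, hxb⟩ := hS (fun l => x l) fun l => (x l).2
      obtain ⟨Z, hZ⟩ := hB' b hb
      refine ⟨Z, ?_⟩
      have h1 := mt (hx b) (by push Not; exact hxb)
      have h2 : ∑ z, μ z * (if ¬ R z b then (1 : ℝ) else 0) +
          ∑ z, μ z * (if R z b then (1 : ℝ) else 0) = 1 := by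
        rw [← Finset.sum_add_distrib]
        refine Eq.trans (Finset.sum_congr rfl fun z _ => ?_) hμ1
        by_cases h : R z b <;> simp [h]
      simp_rw [← hZ]
      linarith
  -- Each `x` now lies in a `ν`-heavy collection of sets, so a net for the dual relation is a cover.
  obtain ⟨g, hg⟩ := hN B' D (fun Z x => R x (r Z))
    (fun Z hZ => hR' (fun j => r (Z j)) fun s => by
      obtain ⟨y, hy⟩ := hZ s
      exact ⟨y, hy⟩) ν hν0 hν1
  exact ⟨fun j => r (g j), fun j => hrS _, fun x hx => hg ⟨x, hx⟩ (hν ⟨x, hx⟩)⟩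

/-! ### From shapes to formulas -/

namespace HonestDefinitions

variable {L : FirstOrder.Language.{u, v}} {n m : ℕ}

/-- The relation defined by `φ(x, y)` in `M`. -/
abbrev formulaRel (φ : L.Formula (Fin n ⊕ Fin m)) (M : Type w) [L.Structure M]
    (x : Fin n → M) (y : Fin m → M) : Prop :=
  φ.Realize (Sum.elim x y)

theorem realize_relabel_castAdd {M : Type w} [L.Structure M] {k k' : ℕ}
    (χ : L.Formula (Fin n ⊕ Fin k)) (x : Fin n → M) (b : Fin k → M) (b' : Fin k' → M) :
    (χ.relabel (Sum.map id (Fin.castAdd k'))).Realize (Sum.elim x (Fin.append b b')) ↔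
      χ.Realize (Sum.elim x b) := by
  rw [Formula.realize_relabel]
  refine iff_of_eq (congrArg _ (funext fun i => ?_))
  rcases i with i | i <;> simp

theorem realize_relabel_natAdd {M : Type w} [L.Structure M] {k k' : ℕ}
    (χ : L.Formula (Fin n ⊕ Fin k')) (x : Fin n → M) (b : Fin k → M) (b' : Fin k' → M) :
    (χ.relabel (Sum.map id (Fin.natAdd k))).Realize (Sum.elim x (Fin.append b b')) ↔
      χ.Realize (Sum.elim x b') := by
  rw [Formula.realize_relabel]
  refine iff_of_eq (congrArg _ (funext fun i => ?_))
  rcases i with i | i <;> simp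

theorem append_mem {M : Type w} {A : Set M} {k k' : ℕ} {b : Fin k → M} {b' : Fin k' → M}
    (hb : ∀ i, b i ∈ A) (hb' : ∀ i, b' i ∈ A) (i : Fin (k + k')) : Fin.append b b' i ∈ A := by
  refine Fin.addCases (fun i => ?_) (fun i => ?_) i
  · simpa using hb i
  · simpa using hb' i

theorem exists_not_pattern_formula (φ : L.Formula (Fin n ⊕ Fin m)) {N : ℕ} (s : Set (Fin N))
    (t : Fin N) : ∃ (k : ℕ) (χ : L.Formula (Fin n ⊕ Fin k)), ∀ (M : Type w) [L.Structure M]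
      (A : Set M) (e : Fin N → Fin n → M), (∀ j i, e j i ∈ A) →
      ∃ b : Fin k → M, (∀ i, b i ∈ A) ∧ ∀ x, χ.Realize (Sum.elim x b) ↔
        ¬ HasPattern (formulaRel φ M) s (Function.update e t x) := by
  -- The parameters flatten the whole tuple `e`; its block at `t` is carried along but never read.
  refine ⟨N * n, ((patternFormula φ s).not).relabel fun p =>
    if p.1 = t then Sum.inl p.2 else Sum.inr (finProdFinEquiv p), fun M _ A e he =>
    ⟨fun i => e (finProdFinEquiv.symm i).1 (finProdFinEquiv.symm i).2, fun i => he _ _,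
      fun x => ?_⟩⟩
  rw [Formula.realize_relabel, Formula.realize_not, realize_patternFormula]
  refine not_congr (exists_congr fun y => forall_congr' fun j => ?_)
  have : (fun i => (Sum.elim x fun i => e (finProdFinEquiv.symm i).1 (finProdFinEquiv.symm i).2)
      (if j = t then Sum.inl i else Sum.inr (finProdFinEquiv (j, i)))) =
      Function.update e t x j := by
    funext i
    by_cases h : j = t
    · subst h; simp
    · simp only [h, if_false, Sum.elim_inr, Equiv.symm_apply_apply, ne_eq, not_false_eq_true,
        Function.update_of_ne]
  exact iff_of_eq (congrArg (fun z => φ.Realize (Sum.elim z y) ↔ j ∈ s) this)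

theorem exists_conj_formula (φ : L.Formula (Fin n ⊕ Fin m)) {N : ℕ}
    (σ : List (Set (Fin N) × Fin N)) :
    ∃ (k : ℕ) (χ : L.Formula (Fin n ⊕ Fin k)), ∀ (M : Type w) [L.Structure M]
      (A : Set M) (c : List ((Set (Fin N) × Fin N) × (Fin N → Fin n → M))),
      c.map Prod.fst = σ → (∀ p ∈ c, ∀ j i, p.2 j i ∈ A) →
      ∃ b : Fin k → M, (∀ i, b i ∈ A) ∧ ∀ x, χ.Realize (Sum.elim x b) ↔
        ∀ p ∈ c, ¬ HasPattern (formulaRel φ M) p.1.1 (Function.update p.2 p.1.2 x) := by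
  induction σ with
  | nil =>
    refine ⟨0, ⊤, fun M _ A c hc _ => ⟨Fin.elim0, fun i => i.elim0, fun x => ?_⟩⟩
    rw [List.map_eq_nil_iff] at hc
    simp [hc]
  | cons p σ ih =>
    obtain ⟨k₁, χ₁, h₁⟩ := exists_not_pattern_formula.{u, v, w} φ p.1 p.2
    obtain ⟨k₂, χ₂, h₂⟩ := ih
    refine ⟨k₁ + k₂, χ₁.relabel (Sum.map id (Fin.castAdd k₂)) ⊓
      χ₂.relabel (Sum.map id (Fin.natAdd k₁)), fun M _ A c hc hA => ?_⟩
    obtain ⟨p', c', rfl, rfl, hc'⟩ := List.map_eq_cons_iff.1 hc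
    obtain ⟨b₁, hb₁, hx₁⟩ := h₁ M A p'.2 (hA p' List.mem_cons_self)
    obtain ⟨b₂, hb₂, hx₂⟩ := h₂ M A c' hc' fun p hp => hA p (List.mem_cons_of_mem _ hp)
    refine ⟨Fin.append b₁ b₂, append_mem hb₁ hb₂, fun x => ?_⟩
    rw [Formula.realize_inf, realize_relabel_castAdd, realize_relabel_natAdd, hx₁, hx₂,
      List.forall_mem_cons]

theorem exists_dnf_formula (φ : L.Formula (Fin n ⊕ Fin m)) {N : ℕ}
    (σ : List (List (Set (Fin N) × Fin N))) :
    ∃ (k : ℕ) (χ : L.Formula (Fin n ⊕ Fin k)), ∀ (M : Type w) [L.Structure M]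
      (A : Set M) (θ : List (List ((Set (Fin N) × Fin N) × (Fin N → Fin n → M)))),
      θ.map (List.map Prod.fst) = σ → (∀ c ∈ θ, ∀ p ∈ c, ∀ j i, p.2 j i ∈ A) →
      ∃ b : Fin k → M, (∀ i, b i ∈ A) ∧ ∀ x, χ.Realize (Sum.elim x b) ↔
        SatisfiesDNF (formulaRel φ M) θ x := by
  induction σ with
  | nil =>
    refine ⟨0, ⊥, fun M _ A θ hθ _ => ⟨Fin.elim0, fun i => i.elim0, fun x => ?_⟩⟩
    rw [List.map_eq_nil_iff] at hθ
    simp [hθ, SatisfiesDNF]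
  | cons c σ ih =>
    obtain ⟨k₁, χ₁, h₁⟩ := exists_conj_formula.{u, v, w} φ c
    obtain ⟨k₂, χ₂, h₂⟩ := ih
    refine ⟨k₁ + k₂, χ₁.relabel (Sum.map id (Fin.castAdd k₂)) ⊔
      χ₂.relabel (Sum.map id (Fin.natAdd k₁)), fun M _ A θ hθ hA => ?_⟩
    obtain ⟨c', θ', rfl, hc', hθ'⟩ := List.map_eq_cons_iff.1 hθ
    obtain ⟨b₁, hb₁, hx₁⟩ := h₁ M A c' hc' (hA c' List.mem_cons_self)
    obtain ⟨b₂, hb₂, hx₂⟩ := h₂ M A θ' hθ' fun p hp => hA p (List.mem_cons_of_mem _ hp)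
    refine ⟨Fin.append b₁ b₂, append_mem hb₁ hb₂, fun x => ?_⟩
    rw [Formula.realize_sup, realize_relabel_castAdd, realize_relabel_natAdd, hx₁, hx₂]
    simp [SatisfiesDNF]

/-- Over sets with two elements, a single formula uniformly defines all unions of instances of
finitely many formulas. -/
theorem exists_union_formula {J : Type} [Finite J] (k : J → ℕ)
    (χ : ∀ j, L.Formula (Fin n ⊕ Fin (k j))) :
    ∃ (K : ℕ) (ξ : L.Formula (Fin n ⊕ Fin K)), ∀ (M : Type w) [L.Structure M] (A : Set M),
      A.Nontrivial → ∀ (J' : Set J) (b : ∀ j, Fin (k j) → M), (∀ j ∈ J', ∀ i, b j i ∈ A) →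
      ∃ b' : Fin K → M, (∀ i, b' i ∈ A) ∧ ∀ x, ξ.Realize (Sum.elim x b') ↔
        ∃ j ∈ J', (χ j).Realize (Sum.elim x (b j)) := by
  classical
  let e : (Σ j, Fin (k j) ⊕ Bool) ≃ Fin (Nat.card (Σ j, Fin (k j) ⊕ Bool)) :=
    Finite.equivFin _
  -- Each disjunct has a switch: it is active exactly when its two extra parameters differ.
  refine ⟨_, Formula.iSup fun j =>
    ((Term.var (Sum.inr (e ⟨j, Sum.inr true⟩)) : L.Term _).equal
      (Term.var (Sum.inr (e ⟨j, Sum.inr false⟩)))).not ⊓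
    (χ j).relabel (Sum.map id fun i => e ⟨j, Sum.inl i⟩), ?_⟩
  rintro M _ A ⟨p, hp, r, hr, hpr⟩ J' b hb
  let b₀ : (Σ j, Fin (k j) ⊕ Bool) → M := fun
    | ⟨j, .inl i⟩ => if j ∈ J' then b j i else p
    | ⟨_, .inr true⟩ => p
    | ⟨j, .inr false⟩ => if j ∈ J' then r else p
  refine ⟨b₀ ∘ e.symm, fun i => ?_, fun x => ?_⟩
  · rw [Function.comp_apply]
    rcases e.symm i with ⟨j, i | i | i⟩
    · by_cases h : j ∈ J'
      · simpa [b₀, h] using hb j h i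
      · simpa [b₀, h] using hp
    · by_cases h : j ∈ J' <;> simpa [b₀, h]
    · exact hp
  · rw [Formula.realize_iSup]
    refine exists_congr fun j => ?_
    rw [Formula.realize_inf, Formula.realize_not, Formula.realize_equal, Formula.realize_relabel]
    by_cases h : j ∈ J'
    · have : Sum.elim x (b₀ ∘ e.symm) ∘ Sum.map id (fun i => e ⟨j, Sum.inl i⟩) =
          Sum.elim x (b j) := by
        funext i; rcases i with i | i <;> simp [b₀, h]
      rw [this]
      simp [b₀, h, hpr]
    · simp [b₀, h]

/-- Since every formula is NIP, the VC bound applies to `φ` with its two groups of variables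
exchanged. -/
theorem TheoryNIP.exists_dual_vcBound {T : L.Theory} (hT : T.IsComplete) (hNIP : TheoryNIP T)
    (φ : L.Formula (Fin n ⊕ Fin m)) :
    ∃ d : ℕ, ∀ (M : Type w) [L.Structure M] [M ⊨ T] [Nonempty M] (y : Fin d → Fin m → M),
      ¬ TupleShattered (fun y x => formulaRel φ M x y) y := by
  obtain ⟨d, hd⟩ := (hNIP _ _ (φ.relabel Sum.swap)).exists_vcBound.{u, v, w} hT
  refine ⟨d, fun M _ _ _ y hy => hd M y ?_⟩
  convert hy using 3 with y x
  have : Sum.elim y x ∘ Sum.swap = Sum.elim x y := by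
    funext i; rcases i with i | i <;> rfl
  rw [Formula.realize_relabel, this]

/-- If any `q` points of a finite set `D` are covered by an instance of `χ` over `A` that is
contained in `S` on `A`, then so is `D` by an instance of a formula `ξ` depending only on `χ`. -/
theorem exists_cover_formula {T : L.Theory} (hT : T.IsComplete) (hNIP : TheoryNIP T) {k : ℕ}
    (χ : L.Formula (Fin n ⊕ Fin k)) :
    ∃ (q K : ℕ) (ξ : L.Formula (Fin n ⊕ Fin K)), ∀ (M : Type w) [L.Structure M] [M ⊨ T]
      (A : Set M), A.Nontrivial → ∀ D S : Set (Fin n → M), D.Finite →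
      (∀ f : Fin q → Fin n → M, (∀ l, f l ∈ D) → ∃ b : Fin k → M, (∀ i, b i ∈ A) ∧
        (∀ l, formulaRel χ M (f l) b) ∧ ∀ x, (∀ i, x i ∈ A) → formulaRel χ M x b → x ∈ S) →
      ∃ b : Fin K → M, (∀ i, b i ∈ A) ∧ (∀ x ∈ D, formulaRel ξ M x b) ∧
        ∀ x, (∀ i, x i ∈ A) → formulaRel ξ M x b → x ∈ S := by
  obtain ⟨d, hd⟩ := (hNIP _ _ χ).exists_vcBound.{u, v, w} hT
  obtain ⟨d', hd'⟩ := hNIP.exists_dual_vcBound.{u, v, w} hT χ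
  obtain ⟨q, N, hqN⟩ := exists_cover_bound.{w} d d'
  obtain ⟨K, ξ, hξ⟩ := exists_union_formula.{u, v, w} (fun _ : Fin N => k) fun _ => χ
  refine ⟨q, K, ξ, fun M _ _ A hA D S hD h => ?_⟩
  have : Nonempty M := ⟨hA.nonempty.some⟩
  -- With `D` empty there may be no instance of `χ` to start from; turning off all disjuncts of `ξ`
  -- gives the empty set.
  rcases D.eq_empty_or_nonempty with rfl | hne
  · obtain ⟨b, hb, hx⟩ := hξ M A hA ∅ (fun _ _ => hA.nonempty.some) (by simp)
    exact ⟨b, hb, by simp, fun x _ hx' => by simp [hx] at hx'⟩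
  · obtain ⟨g, hgS, hgD⟩ := hqN _ _ (formulaRel χ M) (hd M) (hd' M) D hD hne
      {b | (∀ i, b i ∈ A) ∧ ∀ x, (∀ i, x i ∈ A) → formulaRel χ M x b → x ∈ S} fun f hf => by
        obtain ⟨b, h1, h2, h3⟩ := h f hf
        exact ⟨b, ⟨h1, h3⟩, h2⟩
    obtain ⟨b, hb, hx⟩ := hξ M A hA Set.univ g fun j _ => (hgS j).1
    refine ⟨b, hb, fun x hxD => ?_, fun x hxA hx' => ?_⟩
    · obtain ⟨j, hj⟩ := hgD x hxD
      exact (hx x).2 ⟨j, trivial, hj⟩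
    · obtain ⟨j, -, hj⟩ := (hx x).1 hx'
      exact (hgS j).2 x hxA hj

end HonestDefinitions

/-! ### Assembly -/

theorem mainTheorem1 {L : FirstOrder.Language.{u, v}} (T : L.Theory) (hT : T.IsComplete)
    (hNIP : HonestDefinitions.TheoryNIP T) {n m : ℕ} (φ : L.Formula (Fin n ⊕ Fin m)) :
    ∃ (k : ℕ) (χ : L.Formula (Fin n ⊕ Fin k)),
      ∀ (M : Type w) [L.Structure M] [M ⊨ T] (A : Set M), A.Nontrivial →
        ∀ (a : Fin m → M) (A₀ : Set M), A₀ ⊆ A → A₀.Finite →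
          ∃ b : Fin k → M, (∀ j, b j ∈ A) ∧
            HonestDefinitions.trace φ A₀ a = HonestDefinitions.trace χ A₀ b ∧
            HonestDefinitions.trace χ A b ⊆ HonestDefinitions.trace φ A a := by
  classical
  open HonestDefinitions in
  obtain ⟨N, hN⟩ := (hNIP _ _ φ).exists_vcBound.{u, v, w} hT
  choose k χ hχ using fun σ => exists_dnf_formula.{u, v, w} (N := N) φ σ
  choose q K ξ hξ using fun σ => exists_cover_formula.{u, v, w} hT hNIP (χ σ)
  -- The function `q` is fixed for all shapes beforehand, so the finite set `F` may depend on it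
  -- without circularity.
  obtain ⟨F, hF⟩ := exists_honest_shapes.{w} N q
  obtain ⟨K', ζ, hζ⟩ := exists_union_formula.{u, v, w} (fun σ : F => K σ) fun σ => ξ σ
  refine ⟨K', ζ, fun M _ _ A hA a A₀ hA₀ hfin => ?_⟩
  have : Nonempty M := ⟨hA.nonempty.some⟩
  have hD : (trace φ A₀ a).Finite :=
    (Set.Finite.pi' fun _ : Fin n => hfin).subset fun x hx => hx.1
  obtain ⟨σ, hσF, hσ⟩ := hF (Fin n → M) (Fin m → M) (formulaRel φ M) {x | ∀ i, x i ∈ A} a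
    inferInstance (hN M)
  obtain ⟨b, hbA, hbD, hbS⟩ := hξ σ M A hA (trace φ A₀ a) {x | formulaRel φ M x a} hD
    fun f hf => by
      obtain ⟨θ, hθσ, hθA, hθf, hθ⟩ := hσ f fun l => ⟨fun i => hA₀ ((hf l).1 i), (hf l).2⟩
      obtain ⟨b, hb, hx⟩ := hχ σ M A θ hθσ hθA
      exact ⟨b, hb, fun l => (hx _).2 (hθf l), fun x hxA hxb => hθ x hxA ((hx x).1 hxb)⟩
  -- The switches select the one formula of the shape `σ`; the other parameters are arbitrary.
  obtain ⟨b', hb'A, hb'⟩ := hζ M A hA {⟨σ, hσF⟩}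
    (Function.update (fun _ _ => hA.nonempty.some) ⟨σ, hσF⟩ b) (by simpa using hbA)
  have hb'' : ∀ x, ζ.Realize (Sum.elim x b') ↔ formulaRel (ξ σ) M x b := fun x => by
    rw [hb']; simp
  refine ⟨b', hb'A, Set.Subset.antisymm (fun x hx => ?_) fun x hx => ?_, fun x hx => ?_⟩
  · exact ⟨hx.1, (hb'' x).2 (hbD x hx)⟩
  · exact ⟨hx.1, hbS x (fun i => hA₀ (hx.1 i)) ((hb'' x).1 hx.2)⟩
  · exact ⟨hx.1, hbS x hx.1 ((hb'' x).1 hx.2)⟩
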